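/- Let $z$ be an indeterminate, and let $\mathrm{JS}(n,k;z)\in\mathbb Z[z]$ be the Jacobi-Stirling numbers of the second kind, defined by $$x^n=\sum_{k=0}^{n}\mathrm{JS}(n,k;z)\prod_{l=0}^{k-1}\bigl(x-l(z+l)\bigr)\qquad(n\ge 0).$$ For integers $0\le i\le k$ and $n\ge 0$ let $p_{k,i}(n)$ be the coefficient of $z^i$ in $\mathrm{JS}(n+k,n;z)$, and let $$A_{k,i}(t)=\sum_{j\ge 0}a_{k,i,j}t^j:=(1-t)^{3k-i+1}\sum_{n\ge 0}p_{k,i}(n)\,t^n\in\mathbb Z[[t]].$$ Let $R_k$ be the poset on $\{1,2,\dots,3k\}$ whose order is generated by the relations $3m-2<3m$ and $3m-1<3m$ for $1\le m\le k$, and $3m<3m+3$ for $1\le m\le k-1$. For $S\subseteq[k]=\{1,\dots,k\}$ let the Jacobi-Stirling poset $R_{k,S}$ be the subposet of $R_k$ obtained by removing the points $3m-2$ with $m\in S$. Let $\mathscr L(R_{k,S})$ be the set of linear extensions of $R_{k,S}$, each written as the word $\pi$ that lists the elements of $R_{k,S}$ in increasing order with respect to the linear extension. Let $\operatorname{des}\pi$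 be the number of positions $l$ with $\pi_l>\pi_{l+1}$ as integers, and let $$A_{k,S}(t)=\sum_{\pi\in\mathscr L(R_{k,S})}t^{\operatorname{des}\pi+1},\qquad \mathscr L(R_{k,i})=\bigcup_{S\subseteq[k],\,|S|=i}\mathscr L(R_{k,S}).$$ **Theorem.** Let $k\ge 1$ and $0\le i\le k$. Then $$A_{k,i}(t)=\sum_{S\subseteq[k],\ |S|=i}A_{k,S}(t);$$ in particular, $A_{k,i}(t)$ is a polynomial. In other words, for every $j\ge 0$, the integer $a_{k,i,j}$ is the number of elements of $\mathscr L(R_{k,i})$ with exactly $j-1$ descents. -/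

import Mathlib

namespace JacobiStirling

open Polynomial

/-- The Jacobi-Stirling numbers of the second kind `JS(n, k; z)`, as polynomials in `z`
(the variable `X`).  `JS_connection` and `JS_unique` show that they are the connection coefficients
between the monomials `x ^ n` and the polynomials `∏_{i < k} (x - i (z + i))`. -/
noncomputable def JS : ℕ → ℕ → ℤ[X]
  | 0, 0 => 1
  | 0, _ + 1 => 0
  | _ + 1, 0 => 0
  | n + 1, k + 1 => JS n k + ((k : ℤ[X]) + 1) * (((k : ℤ[X]) + 1) + X) * JS n (k + 1)

/-- `∏_{i < k} (x - i (z + i))`; the inner variable is `z`, the outer one is `x`. -/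
noncomputable def node (k : ℕ) : ℤ[X][X] :=
  ∏ i ∈ Finset.range k, (X - C ((i : ℤ[X]) * (X + (i : ℤ[X]))))

theorem JS_eq_zero : ∀ {n k : ℕ}, n < k → JS n k = 0
  | 0, _ + 1, _ => by simp [JS]
  | n + 1, k + 1, h => by
    have h1 : n < k := by omega
    have h2 : n < k + 1 := by omega
    simp [JS, JS_eq_zero h1, JS_eq_zero h2]

theorem node_succ (k : ℕ) :
    node (k + 1) = node k * (X - C ((k : ℤ[X]) * (X + (k : ℤ[X])))) := by
  simp [node, Finset.prod_range_succ]

theorem node_monic (k : ℕ) : (node k).Monic :=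
  monic_prod_of_monic _ _ fun _ _ => monic_X_sub_C _

theorem node_natDegree (k : ℕ) : (node k).natDegree = k := by
  rw [node, natDegree_prod_of_monic _ _ fun _ _ => monic_X_sub_C _]
  simp only [natDegree_X_sub_C, Finset.sum_const, Finset.card_range, smul_eq_mul, mul_one]

/-- `x ^ n = ∑_{k = 0}^{n} JS(n, k; z) ∏_{i < k} (x - i (z + i))`. -/
theorem JS_connection (n : ℕ) :
    (X : ℤ[X][X]) ^ n = ∑ k ∈ Finset.range (n + 1), C (JS n k) * node k := by
  induction n with
  | zero => simp [JS, node]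
  | succ n ih =>
    have key : ∀ k, X * node k = node (k + 1) + C ((k : ℤ[X]) * (X + (k : ℤ[X]))) * node k := by
      intro k
      rw [node_succ]
      ring
    have h1 : (X : ℤ[X][X]) ^ (n + 1) = ∑ k ∈ Finset.range (n + 1), C (JS n k) * node (k + 1)
        + ∑ k ∈ Finset.range (n + 1),
          C (JS n k * ((k : ℤ[X]) * (X + (k : ℤ[X])))) * node k := by
      rw [pow_succ, ih, Finset.sum_mul, ← Finset.sum_add_distrib]
      refine Finset.sum_congr rfl fun k _ => ?_
      rw [mul_assoc, mul_comm (node k), key, mul_add, ← mul_assoc, ← C_mul]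
    rw [h1, Finset.sum_range_succ' (fun k => C (JS (n + 1) k) * node k),
      Finset.sum_range_succ'
        (fun k => C (JS n k * ((k : ℤ[X]) * (X + (k : ℤ[X])))) * node k)]
    have h2 : ∑ k ∈ Finset.range n,
          C (JS n (k + 1) * (((k + 1 : ℕ) : ℤ[X]) * (X + ((k + 1 : ℕ) : ℤ[X])))) * node (k + 1)
        = ∑ k ∈ Finset.range (n + 1),
          C (JS n (k + 1) * (((k + 1 : ℕ) : ℤ[X]) * (X + ((k + 1 : ℕ) : ℤ[X]))))
            * node (k + 1) := by
      rw [Finset.sum_range_succ, JS_eq_zero (Nat.lt_succ_self n)]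
      simp
    rw [h2, ← add_assoc, ← Finset.sum_add_distrib]
    simp only [JS, Nat.cast_zero, zero_mul, mul_zero, map_zero, add_zero]
    refine Finset.sum_congr rfl fun k _ => ?_
    rw [← add_mul, ← C_add]
    congr 2
    push_cast
    ring

/-- The connection coefficients are unique. -/
theorem JS_unique (n : ℕ) (c : ℕ → ℤ[X])
    (h : (X : ℤ[X][X]) ^ n = ∑ k ∈ Finset.range (n + 1), C (c k) * node k) :
    ∀ k ≤ n, c k = JS n k := by
  have main : ∀ (m : ℕ) (d : ℕ → ℤ[X]),
      ∑ k ∈ Finset.range m, C (d k) * node k = 0 → ∀ k < m, d k = 0 := by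
    intro m
    induction m with
    | zero => intro d _ k hk; omega
    | succ m ih =>
      intro d hd
      have hm : d m = 0 := by
        have := congrArg (fun p => coeff p m) hd
        simp only [Finset.sum_range_succ, coeff_add, finsetSum_coeff, coeff_C_mul, coeff_zero]
          at this
        rw [Finset.sum_eq_zero] at this
        · have hc : (node m).coeff m = 1 := by
            have := node_monic m
            rwa [Monic, leadingCoeff, node_natDegree] at this
          simpa [hc] using this
        · intro k hk
          rw [coeff_eq_zero_of_natDegree_lt, mul_zero]
          rw [node_natDegree]
          exact Finset.mem_range.1 hk
      rw [Finset.sum_range_succ, hm, C_0, zero_mul, add_zero] at hd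
      intro k hk
      rcases Nat.lt_succ_iff_lt_or_eq.1 hk with h' | h'
      · exact ih d hd k h'
      · rw [h', hm]
  intro k hk
  have := main (n + 1) (fun k => c k - JS n k) (by
    simp only [C_sub, sub_mul, Finset.sum_sub_distrib]
    rw [← h, ← JS_connection, sub_self]) k (by omega)
  exact sub_eq_zero.1 this

/-- The Jacobi-Stirling coefficient `p_{k,i}(n)`: the coefficient of `z ^ i` in
`f_k(n; z) = JS(n + k, n; z)`. -/
noncomputable def p (k i n : ℕ) : ℤ := (JS (n + k) n).coeff i

/-- `A_{k,i}(t) = (1 - t) ^ (3k - i + 1) ∑_{n ≥ 0} p_{k,i}(n) t ^ n`, as a formal power series;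
its coefficient of `t ^ j` is `a_{k,i,j}`. Used only for `i ≤ k`. -/
noncomputable def A (k i : ℕ) : PowerSeries ℤ :=
  (1 - PowerSeries.X) ^ (3 * k - i + 1) * PowerSeries.mk (p k i)

/-- The underlying set of the labeled poset `R_k`; each point is its label in `{1, …, 3k}`. -/
def R (k : ℕ) : Type := {l : ℕ // l ∈ Finset.Icc 1 (3 * k)}

instance (k : ℕ) : Fintype (R k) := inferInstanceAs (Fintype {l : ℕ // l ∈ Finset.Icc 1 (3 * k)})

instance (k : ℕ) : DecidableEq (R k) :=
  inferInstanceAs (DecidableEq {l : ℕ // l ∈ Finset.Icc 1 (3 * k)})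

/-- The edges of the Hasse diagram of `R_k`: for each `m`, the points `3m - 2` and `3m - 1` lie
directly below `3m`, and `3m` lies directly below `3m + 3`. -/
def Edge {k : ℕ} (x y : R k) : Prop :=
  ∃ m : ℕ, (x.1 + 2 = 3 * m ∧ y.1 = 3 * m) ∨ (x.1 + 1 = 3 * m ∧ y.1 = 3 * m) ∨
    (x.1 = 3 * m ∧ y.1 = 3 * m + 3)

theorem edge_closure_iff {k : ℕ} (x y : R k) :
    Relation.ReflTransGen Edge x y ↔ x = y ∨ (3 ∣ y.1 ∧ x.1 ≤ y.1) := by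
  constructor
  · intro h
    induction h with
    | refl => exact Or.inl rfl
    | tail _ hbc ih =>
      right
      obtain ⟨m, hm⟩ := hbc
      rcases ih with rfl | ⟨_, ih⟩ <;> omega
  · rintro (rfl | ⟨⟨b, hb⟩, hxy⟩)
    · exact Relation.ReflTransGen.refl
    · induction b generalizing y with
      | zero =>
        have := (Finset.mem_Icc.1 y.2).1
        omega
      | succ b ih =>
        by_cases hx : x.1 ≤ 3 * b
        · have h1 := Finset.mem_Icc.1 x.2
          have h2 := Finset.mem_Icc.1 y.2
          refine Relation.ReflTransGen.tail
            (ih ⟨3 * b, Finset.mem_Icc.2 ⟨by omega, by omega⟩⟩ hx rfl) ⟨b, ?_⟩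
          exact Or.inr (Or.inr ⟨rfl, by omega⟩)
        · by_cases hxy' : x.1 = y.1
          · rw [show x = y from Subtype.ext hxy']
          · exact Relation.ReflTransGen.single ⟨b + 1, by omega⟩

/-- The partial order of `R_k`, generated by the edges of its Hasse diagram. -/
instance (k : ℕ) : PartialOrder (R k) where
  le := Relation.ReflTransGen Edge
  le_refl _ := Relation.ReflTransGen.refl
  le_trans _ _ _ := Relation.ReflTransGen.trans
  le_antisymm x y h h' := by
    rcases (edge_closure_iff x y).1 h with e | ⟨_, h1⟩
    · exact e
    rcases (edge_closure_iff y x).1 h' with e | ⟨_, h2⟩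
    · exact e.symm
    exact Subtype.ext (le_antisymm h1 h2)

theorem R_le_iff {k : ℕ} (x y : R k) : x ≤ y ↔ x = y ∨ (3 ∣ y.1 ∧ x.1 ≤ y.1) :=
  edge_closure_iff x y

instance (k : ℕ) : DecidableLE (R k) := fun x y => decidable_of_iff' _ (R_le_iff x y)

/-- The Jacobi-Stirling poset `R_{k,S}`: the points `3m - 2` with `m ∈ S` are removed from `R_k`;
the order is the induced one. -/
abbrev RS (k : ℕ) (S : Finset ℕ) : Type := {x : R k // ¬ ∃ m ∈ S, x.1 + 2 = 3 * m}

/-- The linear extensions of a finite poset `P`, each given by the enumeration of `P` in increasing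
order with respect to the total order that extends the order of `P`. -/
abbrev LinExt (P : Type) [Fintype P] [PartialOrder P] : Type :=
  {e : Fin (Fintype.card P) ≃ P // ∀ a b, e a ≤ e b → a ≤ b}

/-- The set `𝓛(R_{k,S})` of linear extensions of `R_{k,S}`, each written as the word of the labels
in increasing order with respect to the linear extension. -/
def L (k : ℕ) (S : Finset ℕ) : Finset (List ℕ) :=
  (Finset.univ : Finset (LinExt (RS k S))).image fun e => List.ofFn fun a => (e.1 a).1.1

/-- The number of descents of a word. -/
def des (w : List ℕ) : ℕ := (w.zip w.tail).countP fun q => q.2 < q.1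

/-- The descent polynomial `A_{k,S}(t)`: the coefficient of `t ^ j` is the number of elements of
`𝓛(R_{k,S})` with `j - 1` descents. -/
noncomputable def descentPoly (k : ℕ) (S : Finset ℕ) : ℤ[X] := ∑ w ∈ L k S, X ^ (des w + 1)

/-- `𝓛(R_{k,i})`, the union of the sets `𝓛(R_{k,S})` over the `i`-element subsets `S` of
`{1, …, k}`. -/
def LUnion (k i : ℕ) : Finset (List ℕ) :=
  (Finset.powersetCard i (Finset.Icc 1 k)).biUnion fun S => L k S

end JacobiStirling

namespace JacobiStirling

open Polynomial

/-! Both sides are compared with the order polynomials of the posets. The recurrence for `JS` at (n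
+ 1 + (k + 1), n + 1) has weight (n + 1)(n + 1 + z): its term (n + 1)² belongs to k + 1 ∉ S, its
term (n + 1)z to k + 1 ∈ S. Iterating gives JS(n + k, n; z) = ∑_S `orderPoly S k n` z^|S|
(`JS_add_eq_sum_orderPoly`).

On the poset side, R_{k+1,S} arises from R_{k,S} by adding one or two isolated points and then a
greatest element. With the new labels exceeding the old ones, a free point multiplies the
enumerating function by n, and the greatest element replaces it by its partial sums. By induction ∑
t^(des + 1) over 𝓛(R_{k,S}), divided by (1 - t)^(|R_{k,S}| + 1), generates the order polynomial
(`enumerates_L`). As |R_{k,S}| = 3k - |S|, all S of size i share one denominator. -/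

/-! ### Linear extensions as words -/

/-- `x` may precede `y` in a linear extension of a Jacobi-Stirling poset. -/
def MayPrecede (x y : ℕ) : Prop := x ≠ y ∧ (3 ∣ x → x < y)

/-- `l` is a label of `R_{k,S}`. -/
def IsLabel (k : ℕ) (S : Finset ℕ) (l : ℕ) : Prop :=
  (1 ≤ l ∧ l ≤ 3 * k) ∧ ¬ ∃ m ∈ S, l + 2 = 3 * m

/-- `MayPrecede x y` is the negation of y ≤ x in the poset, so bijective enumerations become words
to which letters can be added. -/
theorem mem_L {k : ℕ} {S : Finset ℕ} {w : List ℕ} :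
    w ∈ L k S ↔ w.Pairwise MayPrecede ∧ ∀ l, l ∈ w ↔ IsLabel k S l := by
  simp only [L, Finset.mem_image, Finset.mem_univ, true_and]
  constructor
  · rintro ⟨e, rfl⟩
    refine ⟨List.pairwise_ofFn.2 fun a b hab => ⟨fun h => ?_, fun h => ?_⟩, fun l => ?_⟩
    · exact hab.ne (e.1.injective (Subtype.ext (Subtype.ext h)))
    · by_contra hlt
      have hle : e.1 b ≤ e.1 a := (R_le_iff _ _).2 (Or.inr ⟨h, not_lt.1 hlt⟩)
      exact absurd (e.2 _ _ hle) (not_le.2 hab)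
    · rw [List.mem_ofFn]
      constructor
      · rintro ⟨a, rfl⟩
        exact ⟨Finset.mem_Icc.1 (e.1 a).1.2, (e.1 a).2⟩
      · rintro ⟨h1, h2⟩
        exact ⟨e.1.symm ⟨⟨l, Finset.mem_Icc.2 h1⟩, h2⟩, by simp⟩
  · rintro ⟨hp, hm⟩
    have hnd : w.Nodup := hp.imp fun h => h.1
    have hl : ∀ a : Fin w.length, IsLabel k S (w.get a) := fun a => (hm _).1 (List.get_mem _ _)
    let f : Fin w.length → RS k S := fun a => ⟨⟨w.get a, Finset.mem_Icc.2 (hl a).1⟩, (hl a).2⟩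
    have hf : Function.Bijective f := by
      constructor
      · intro a b hab
        exact hnd.injective_get (congrArg (fun x : RS k S => x.1.1) hab)
      · intro x
        obtain ⟨a, ha⟩ := List.get_of_mem ((hm x.1.1).2 ⟨Finset.mem_Icc.1 x.1.2, x.2⟩)
        exact ⟨a, Subtype.ext (Subtype.ext ha)⟩
    have hc : Fintype.card (RS k S) = w.length := by
      simpa using (Fintype.card_congr (Equiv.ofBijective f hf)).symm
    refine ⟨⟨(finCongr hc).trans (Equiv.ofBijective f hf), fun a b hab => ?_⟩, ?_⟩
    · by_contra hba
      have hlt : finCongr hc b < finCongr hc a := not_le.1 hba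
      have hr := List.pairwise_iff_get.1 hp _ _ hlt
      rcases (R_le_iff _ _).1 hab with h | ⟨h3, hle⟩
      · exact hr.1 (congrArg Subtype.val h).symm
      · exact absurd (hr.2 h3) (not_lt.2 hle)
    · exact List.ext_getElem (by simp [hc]) fun a h1 h2 => by simp [f]

/-! ### Descents under insertion of a largest letter -/

/-- The words that arise by inserting the letter `x` into a word of `W`. -/
def insertions (x : ℕ) (W : Finset (List ℕ)) : Finset (List ℕ) :=
  W.biUnion fun w => (Finset.range (w.length + 1)).image fun j => w.insertIdx j x

theorem insertIdx_eq (w : List ℕ) (j x : ℕ) (hj : j ≤ w.length) :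
    w.insertIdx j x = w.take j ++ x :: w.drop j := by
  induction w generalizing j with
  | nil => simp_all
  | cons a w ih =>
    cases j with
    | zero => simp
    | succ j => simpa using ih j (by simpa using hj)

theorem mem_insertions {x : ℕ} {W : Finset (List ℕ)} {v : List ℕ} :
    v ∈ insertions x W ↔ ∃ s t, s ++ t ∈ W ∧ v = s ++ x :: t := by
  simp only [insertions, Finset.mem_biUnion, Finset.mem_image, Finset.mem_range]
  constructor
  · rintro ⟨w, hw, j, hj, rfl⟩
    exact ⟨w.take j, w.drop j, by simpa using hw, insertIdx_eq w j x (by omega)⟩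
  · rintro ⟨s, t, h, rfl⟩
    refine ⟨_, h, s.length, by simp, ?_⟩
    rw [insertIdx_eq _ _ _ (by simp)]
    simp

theorem des_cons_cons (a b : ℕ) (w : List ℕ) :
    des (a :: b :: w) = des (b :: w) + if b < a then 1 else 0 := by
  simp [des, List.countP_cons]

theorem des_zero_cons (w : List ℕ) : des (0 :: w) = des w := by
  cases w with
  | nil => rfl
  | cons b w => simp [des_cons_cons]

theorem des_append_max (w : List ℕ) (x : ℕ) (h : ∀ l ∈ w, l < x) : des (w ++ [x]) = des w := by
  induction w with
  | nil => rfl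
  | cons a w ih =>
    have ih := ih fun l hl => h l (List.mem_cons_of_mem _ hl)
    have ha := h a List.mem_cons_self
    cases w with
    | nil => simp [des, ha.le]
    | cons b w =>
      rw [List.cons_append, List.cons_append, des_cons_cons, des_cons_cons, ← ih]
      rfl

/-- A largest letter put into a descent or at the end keeps the number of descents; any other
position adds one. The prefixed letter `a` makes the front an ordinary gap, so the induction runs;
later `a = 0` creates no descent. -/
theorem sum_des_cons_insertIdx {A : Type*} [CommRing A] (y : A) (x : ℕ) (w : List ℕ) (a : ℕ)
    (ha : a < x) (h : ∀ l ∈ w, l < x) :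
    ∑ j ∈ Finset.range (w.length + 1), y ^ des (a :: w.insertIdx j x) =
      ((des (a :: w) : A) + 1) * y ^ des (a :: w) +
        ((w.length : A) - des (a :: w)) * y ^ (des (a :: w) + 1) := by
  induction w generalizing a with
  | nil => simp [des, ha.le]
  | cons b w ih =>
    have hb := h b List.mem_cons_self
    have ih := ih b hb fun l hl => h l (List.mem_cons_of_mem _ hl)
    rw [List.length_cons, Finset.sum_range_succ']
    simp only [List.insertIdx_succ_cons, List.insertIdx_zero, des_cons_cons a, des_cons_cons x b,
      pow_add _ (des (b :: _)), if_pos hb, if_neg ha.le.not_gt]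
    rw [← Finset.sum_mul, ih]
    split_ifs <;> push_cast <;> ring

theorem sum_des_insertIdx {A : Type*} [CommRing A] (y : A) (x : ℕ) (w : List ℕ)
    (hx : 0 < x) (h : ∀ l ∈ w, l < x) :
    ∑ j ∈ Finset.range (w.length + 1), y ^ (des (w.insertIdx j x) + 1) =
      ((des w : A) + 1) * y ^ (des w + 1) + ((w.length : A) - des w) * y ^ (des w + 2) := by
  have := sum_des_cons_insertIdx y x w 0 hx h
  simp only [des_zero_cons] at this
  simp only [pow_succ _ (des (w.insertIdx _ _)), ← Finset.sum_mul, this]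
  ring

theorem sum_insertions {A : Type*} [AddCommMonoid A] (f : List ℕ → A) (x : ℕ)
    (W : Finset (List ℕ)) (h : ∀ w ∈ W, x ∉ w) :
    ∑ v ∈ insertions x W, f v =
      ∑ w ∈ W, ∑ j ∈ Finset.range (w.length + 1), f (w.insertIdx j x) := by
  rw [insertions, Finset.sum_biUnion]
  · refine Finset.sum_congr rfl fun w hw => Finset.sum_image fun i hi j hj hij => ?_
    refine List.injOn_insertIdx_index_of_notMem w x (h w hw) ?_ ?_ hij
    · simpa [Nat.lt_succ_iff] using hi
    · simpa [Nat.lt_succ_iff] using hj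
  -- Erasing `x` recovers the original word, so distinct words have disjoint sets of insertions.
  · have key : ∀ w ∈ W, ∀ j < w.length + 1, (w.insertIdx j x).erase x = w := by
      intro w hw j hj
      rw [insertIdx_eq w j x (by omega),
        List.erase_append_right _ fun hm => h w hw (List.mem_of_mem_take hm)]
      simp
    intro w hw w' hw' hne
    refine Finset.disjoint_left.2 fun v hv hv' => hne ?_
    simp only [Finset.mem_image, Finset.mem_range] at hv hv'
    obtain ⟨j, hj, rfl⟩ := hv
    obtain ⟨j', hj', e⟩ := hv'
    rw [← key w hw j hj, ← key w' hw' j' hj', e]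


/-! ### Recursive construction of the linear extensions -/

/-- `W` is the set of all words without repeated letters on the alphabet `U` that respect
`MayPrecede`. -/
def IsWordSet (U : ℕ → Prop) (W : Finset (List ℕ)) : Prop :=
  ∀ w, w ∈ W ↔ w.Pairwise MayPrecede ∧ ∀ l, l ∈ w ↔ U l

theorem isWordSet_L (k : ℕ) (S : Finset ℕ) : IsWordSet (IsLabel k S) (L k S) := fun _ => mem_L

theorem IsWordSet.congr {U V : ℕ → Prop} {W : Finset (List ℕ)} (h : IsWordSet U W)
    (huv : ∀ l, U l ↔ V l) : IsWordSet V W := by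
  rwa [show V = U from funext fun l => propext (huv l).symm]

theorem IsWordSet.eq {U : ℕ → Prop} {W W' : Finset (List ℕ)} (h : IsWordSet U W)
    (h' : IsWordSet U W') : W = W' :=
  Finset.ext fun w => (h w).trans (h' w).symm

theorem pairwise_mayPrecede_insert {s t : List ℕ} {x : ℕ} (hx : ∀ l ∈ s ++ t, l < x) :
    (s ++ x :: t).Pairwise MayPrecede ↔
      (s ++ t).Pairwise MayPrecede ∧ ∀ l ∈ t, MayPrecede x l := by
  simp only [List.pairwise_append, List.pairwise_cons, List.mem_cons, forall_eq_or_imp]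
  have hs : ∀ l ∈ s, MayPrecede l x := fun l hl =>
    have := hx l (List.mem_append_left _ hl)
    ⟨this.ne, fun _ => this⟩
  constructor
  · rintro ⟨h1, ⟨h2, h3⟩, h4⟩
    exact ⟨⟨h1, h3, fun a ha => (h4 a ha).2⟩, h2⟩
  · rintro ⟨⟨h1, h3, h4⟩, h2⟩
    exact ⟨h1, ⟨h2, h3⟩, fun a ha => ⟨hs a ha, h4 a ha⟩⟩

/-- Removing the largest letter `x` from a word. -/
theorem word_insert_iff {U : ℕ → Prop} {s t : List ℕ} {x : ℕ} (hx : ∀ l, U l → l < x) :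
    ((s ++ x :: t).Pairwise MayPrecede ∧ ∀ l, l ∈ s ++ x :: t ↔ l = x ∨ U l) ↔
      ((s ++ t).Pairwise MayPrecede ∧ ∀ l, l ∈ s ++ t ↔ U l) ∧ ∀ l ∈ t, MayPrecede x l := by
  constructor
  · rintro ⟨hp, hm⟩
    have hne : ∀ l ∈ s ++ t, l ≠ x := by
      intro l hl
      rw [List.pairwise_append, List.pairwise_cons] at hp
      rcases List.mem_append.1 hl with h | h
      · exact (hp.2.2 l h x List.mem_cons_self).1
      · exact (hp.2.1.1 l h).1.symm
    have hm' : ∀ l, l ∈ s ++ t ↔ U l := by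
      intro l
      have h1 := hm l
      simp only [List.mem_append, List.mem_cons] at h1 ⊢
      constructor
      · intro h
        exact (h1.1 (by tauto)).resolve_left (hne l (List.mem_append.2 h))
      · intro h
        have h2 := h1.2 (Or.inr h)
        have h3 := (hx l h).ne
        tauto
    obtain ⟨h1, h2⟩ := (pairwise_mayPrecede_insert fun l hl => hx l ((hm' l).1 hl)).1 hp
    exact ⟨⟨h1, hm'⟩, h2⟩
  · rintro ⟨⟨h1, hm⟩, h2⟩
    refine ⟨(pairwise_mayPrecede_insert fun l hl => hx l ((hm l).1 hl)).2 ⟨h1, h2⟩, fun l => ?_⟩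
    rw [← hm l]
    simp only [List.mem_append, List.mem_cons]
    tauto

theorem IsWordSet.insertions {U : ℕ → Prop} {W : Finset (List ℕ)} (h : IsWordSet U W) {x : ℕ}
    (hx : ∀ l, U l → l < x) (h3 : ¬ 3 ∣ x) :
    IsWordSet (fun l => l = x ∨ U l) (insertions x W) := by
  intro v
  rw [mem_insertions]
  constructor
  · rintro ⟨s, t, hst, rfl⟩
    have hst := (h _).1 hst
    refine (word_insert_iff hx).2 ⟨hst, fun l hl => ⟨?_, fun h => absurd h h3⟩⟩
    exact (hx l ((hst.2 l).1 (List.mem_append_right _ hl))).ne'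
  · intro hv
    obtain ⟨s, t, rfl⟩ := List.append_of_mem ((hv.2 x).2 (Or.inl rfl))
    exact ⟨s, t, (h _).2 ((word_insert_iff hx).1 hv).1, rfl⟩

/-- A multiple of 3 may precede only larger letters, so as the largest letter it must come last. -/
theorem IsWordSet.image_append {U : ℕ → Prop} {W : Finset (List ℕ)} (h : IsWordSet U W) {x : ℕ}
    (hx : ∀ l, U l → l < x) (h3 : 3 ∣ x) :
    IsWordSet (fun l => l = x ∨ U l) (W.image (· ++ [x])) := by
  intro v
  rw [Finset.mem_image]
  constructor
  · rintro ⟨w, hw, rfl⟩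
    refine (word_insert_iff (t := []) hx).2 ⟨by simpa using (h w).1 hw, by simp⟩
  · intro hv
    obtain ⟨s, t, rfl⟩ := List.append_of_mem ((hv.2 x).2 (Or.inl rfl))
    have hst := (word_insert_iff hx).1 hv
    cases t with
    | nil => exact ⟨s, (h s).2 (by simpa using hst.1), rfl⟩
    | cons a t =>
      have h1 := (hst.2 a List.mem_cons_self).2 h3
      have h2 := hx a ((hst.1.2 a).1 (by simp))
      omega

theorem L_zero (S : Finset ℕ) : L 0 S = {[]} := by
  ext w
  rw [mem_L, Finset.mem_singleton]
  constructor
  · rintro ⟨-, h⟩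
    refine List.eq_nil_iff_forall_not_mem.2 fun l hl => ?_
    have := ((h l).1 hl).1
    omega
  · rintro rfl
    refine ⟨List.Pairwise.nil, fun l => ?_⟩
    simp only [List.not_mem_nil, IsLabel, false_iff]
    omega

theorem isLabel_succ {k : ℕ} {S : Finset ℕ} {l : ℕ} :
    IsLabel (k + 1) S l ↔
      l = 3 * k + 3 ∨ l = 3 * k + 2 ∨ (k + 1 ∉ S ∧ l = 3 * k + 1) ∨ IsLabel k S l := by
  constructor
  · rintro ⟨h1, h2⟩
    by_cases hl : l ≤ 3 * k
    · exact Or.inr (Or.inr (Or.inr ⟨⟨h1.1, hl⟩, h2⟩))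
    · by_cases e : l = 3 * k + 1
      · exact Or.inr (Or.inr (Or.inl ⟨fun h => h2 ⟨k + 1, h, by omega⟩, e⟩))
      · omega
  · rintro (rfl | rfl | ⟨h, rfl⟩ | ⟨h1, h2⟩)
    · exact ⟨by omega, fun ⟨m, _, hm⟩ => by omega⟩
    · exact ⟨by omega, fun ⟨m, _, hm⟩ => by omega⟩
    · refine ⟨by omega, fun ⟨m, hm, e⟩ => h ?_⟩
      rwa [show k + 1 = m by omega]
    · exact ⟨by omega, h2⟩

theorem IsLabel.lt {k : ℕ} {S : Finset ℕ} {l : ℕ} (h : IsLabel k S l) : l < 3 * k + 1 :=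
  Nat.lt_succ_of_le h.1.2

theorem L_succ_of_mem {k : ℕ} {S : Finset ℕ} (h : k + 1 ∈ S) :
    L (k + 1) S = (insertions (3 * k + 2) (L k S)).image (· ++ [3 * k + 3]) := by
  refine (isWordSet_L _ _).eq (((((isWordSet_L k S).insertions (x := 3 * k + 2) ?_ ?_).image_append
    (x := 3 * k + 3) ?_ ?_)).congr fun l => ?_)
  · exact fun l hl => hl.lt.trans (by omega)
  · omega
  · rintro l (rfl | hl)
    · omega
    · exact hl.lt.trans (by omega)
  · omega
  · simp [isLabel_succ, h]

theorem L_succ_of_notMem {k : ℕ} {S : Finset ℕ} (h : k + 1 ∉ S) :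
    L (k + 1) S =
      (insertions (3 * k + 2) (insertions (3 * k + 1) (L k S))).image (· ++ [3 * k + 3]) := by
  refine (isWordSet_L _ _).eq ((((((isWordSet_L k S).insertions (x := 3 * k + 1) ?_ ?_).insertions
    (x := 3 * k + 2) ?_ ?_)).image_append (x := 3 * k + 3) ?_ ?_).congr fun l => ?_)
  · exact fun l hl => hl.lt
  · omega
  · rintro l (rfl | hl)
    · omega
    · exact hl.lt.trans (by omega)
  · omega
  · rintro l (rfl | rfl | hl)
    · omega
    · omega
    · exact hl.lt.trans (by omega)
  · omega
  · simp [isLabel_succ, h]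

/-! ### Descent series and generating functions -/

/-- The descent generating function of a set of words. -/
noncomputable def desSeries (W : Finset (List ℕ)) : PowerSeries ℤ :=
  ∑ w ∈ W, PowerSeries.X ^ (des w + 1)

theorem desSeries_image_append {W : Finset (List ℕ)} {x : ℕ} (h : ∀ w ∈ W, ∀ l ∈ w, l < x) :
    desSeries (W.image (· ++ [x])) = desSeries W := by
  rw [desSeries, Finset.sum_image fun a _ b _ hab => List.append_cancel_right hab]
  exact Finset.sum_congr rfl fun w hw => by rw [des_append_max w x (h w hw)]

theorem desSeries_insertions {W : Finset (List ℕ)} {x p : ℕ} (hx : 0 < x)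
    (h : ∀ w ∈ W, ∀ l ∈ w, l < x) (hp : ∀ w ∈ W, w.length = p) :
    desSeries (insertions x W) = PowerSeries.X *
      ((1 - PowerSeries.X) * PowerSeries.derivative ℤ (desSeries W) +
        ((p : PowerSeries ℤ) + 1) * desSeries W) := by
  rw [desSeries, sum_insertions _ _ _ fun w hw hxw => (h w hw x hxw).ne rfl, desSeries, map_sum,
    Finset.mul_sum, Finset.mul_sum, ← Finset.sum_add_distrib, Finset.mul_sum]
  refine Finset.sum_congr rfl fun w hw => ?_
  rw [sum_des_insertIdx _ _ _ hx (h w hw), hp w hw, Derivation.leibniz_pow]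
  simp
  ring

theorem length_of_mem_insertions {W : Finset (List ℕ)} {x p : ℕ} (hp : ∀ w ∈ W, w.length = p) :
    ∀ v ∈ insertions x W, v.length = p + 1 := by
  intro v hv
  obtain ⟨s, t, hst, rfl⟩ := mem_insertions.1 hv
  have := hp _ hst
  simp only [List.length_append, List.length_cons] at this ⊢
  omega

theorem lt_of_mem_insertions {W : Finset (List ℕ)} {x y : ℕ} (h : ∀ w ∈ W, ∀ l ∈ w, l < y)
    (hxy : x < y) : ∀ v ∈ insertions x W, ∀ l ∈ v, l < y := by
  intro v hv l hl
  obtain ⟨s, t, hst, rfl⟩ := mem_insertions.1 hv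
  have := h _ hst l
  simp only [List.mem_append, List.mem_cons] at this hl
  rcases hl with hl | rfl | hl
  · exact this (Or.inl hl)
  · exact hxy
  · exact this (Or.inr hl)

/-- The words of `W` have length `n`, and `∑_{w ∈ W} t ^ (des w + 1) / (1 - t) ^ (n + 1)` is the
generating function of `f`. -/
def Enumerates (W : Finset (List ℕ)) (n : ℕ) (f : ℕ → ℤ) : Prop :=
  (∀ w ∈ W, w.length = n) ∧ (1 - PowerSeries.X) ^ (n + 1) * PowerSeries.mk f = desSeries W

theorem X_mul_derivative_mk (f : ℕ → ℤ) :
    PowerSeries.X * PowerSeries.derivative ℤ (PowerSeries.mk f) =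
      PowerSeries.mk fun n => (n : ℤ) * f n := by
  ext n
  cases n with
  | zero => simp
  | succ n =>
    rw [PowerSeries.coeff_succ_X_mul, PowerSeries.coeff_derivative]
    simp [mul_comm]

theorem one_sub_X_mul_mk_sum (f : ℕ → ℤ) :
    (1 - PowerSeries.X) * PowerSeries.mk (fun n => ∑ m ∈ Finset.range (n + 1), f m) =
      PowerSeries.mk f := by
  ext n
  rw [sub_mul, one_mul, map_sub]
  cases n with
  | zero => simp
  | succ n => simp [PowerSeries.coeff_succ_X_mul, Finset.sum_range_succ _ (n + 1)]

/-- For D = (1 - t)^(n + 1) F, the insertion operator t((1 - t)D' + (n + 1)D) collapses to (1 -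
t)^(n + 2) t F'. -/
theorem Enumerates.insertions {W : Finset (List ℕ)} {n : ℕ} {f : ℕ → ℤ} (h : Enumerates W n f)
    {x : ℕ} (hx : 0 < x) (hW : ∀ w ∈ W, ∀ l ∈ w, l < x) :
    Enumerates (insertions x W) (n + 1) fun m => (m : ℤ) * f m := by
  refine ⟨length_of_mem_insertions h.1, ?_⟩
  rw [desSeries_insertions hx hW h.1, ← h.2, ← X_mul_derivative_mk, Derivation.leibniz,
    Derivation.leibniz_pow]
  simp
  ring

theorem Enumerates.image_append {W : Finset (List ℕ)} {n : ℕ} {f : ℕ → ℤ} (h : Enumerates W n f)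
    {x : ℕ} (hW : ∀ w ∈ W, ∀ l ∈ w, l < x) :
    Enumerates (W.image (· ++ [x])) (n + 1) fun m => ∑ j ∈ Finset.range (m + 1), f j := by
  constructor
  · intro v hv
    obtain ⟨w, hw, rfl⟩ := Finset.mem_image.1 hv
    simp [h.1 w hw]
  · rw [desSeries_image_append hW, pow_succ, mul_assoc, one_sub_X_mul_mk_sum, h.2]

/-! ### Order polynomials and Jacobi-Stirling numbers -/

/-- The number of elements of `R_{k,S}`. -/
def size (S : Finset ℕ) : ℕ → ℕ
  | 0 => 0
  | k + 1 => size S k + if k + 1 ∈ S then 2 else 3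

/-- The number of order-preserving maps from `R_{k,S}` to `{1, …, n}`. -/
def orderPoly (S : Finset ℕ) : ℕ → ℕ → ℤ
  | 0, n => if n = 0 then 0 else 1
  | k + 1, n => ∑ m ∈ Finset.range (n + 1),
      (m : ℤ) ^ (if k + 1 ∈ S then 1 else 2) * orderPoly S k m

theorem enumerates_L (k : ℕ) (S : Finset ℕ) : Enumerates (L k S) (size S k) (orderPoly S k) := by
  induction k with
  | zero =>
    -- The empty word contributes t, and t/(1 - t) has constant term 0; hence the value 0 of
    -- `orderPoly S 0` at 0.
    refine ⟨by simp [L_zero, size], ?_⟩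
    rw [L_zero]
    ext n
    rw [size, zero_add, pow_one, sub_mul, one_mul, map_sub]
    rcases n with _ | _ | n <;>
      simp [desSeries, des, orderPoly, PowerSeries.coeff_succ_X_mul, PowerSeries.coeff_X]
  | succ k ih =>
    have hlt : ∀ w ∈ L k S, ∀ l ∈ w, l < 3 * k + 1 := fun w hw l hl => (((mem_L.1 hw).2 l).1 hl).lt
    have hlt2 : ∀ w ∈ L k S, ∀ l ∈ w, l < 3 * k + 2 :=
      fun w hw l hl => (hlt w hw l hl).trans (by omega)
    have hlt3 : ∀ w ∈ L k S, ∀ l ∈ w, l < 3 * k + 3 :=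
      fun w hw l hl => (hlt w hw l hl).trans (by omega)
    by_cases h : k + 1 ∈ S
    · have := (ih.insertions (x := 3 * k + 2) (by omega) hlt2).image_append (x := 3 * k + 3)
        (lt_of_mem_insertions hlt3 (by omega))
      rw [L_succ_of_mem h]
      simpa [size, orderPoly, h] using this
    · have := ((ih.insertions (x := 3 * k + 1) (by omega) hlt).insertions (x := 3 * k + 2)
        (by omega) (lt_of_mem_insertions hlt2 (by omega))).image_append (x := 3 * k + 3)
        (lt_of_mem_insertions (lt_of_mem_insertions hlt3 (by omega)) (by omega))
      rw [L_succ_of_notMem h]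
      simpa [size, orderPoly, h, pow_two, mul_assoc] using this

theorem Icc_one_succ (k : ℕ) : Finset.Icc 1 (k + 1) = insert (k + 1) (Finset.Icc 1 k) := by
  ext; simp; omega

theorem size_eq {S : Finset ℕ} {k : ℕ} (h : S ⊆ Finset.Icc 1 k) : size S k = 3 * k - S.card := by
  have key : size S k + (S ∩ Finset.Icc 1 k).card = 3 * k := by
    clear h
    induction k with
    | zero => simp [size]
    | succ k ih =>
      rw [Icc_one_succ, size]
      by_cases hk : k + 1 ∈ S
      · rw [Finset.inter_insert_of_mem hk, Finset.card_insert_of_notMem (by simp), if_pos hk]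
        omega
      · rw [Finset.inter_insert_of_notMem hk, if_neg hk]
        omega
  rw [Finset.inter_eq_left.2 h] at key
  omega

theorem orderPoly_insert {S : Finset ℕ} {a k : ℕ} (h : k < a) (n : ℕ) :
    orderPoly (insert a S) k n = orderPoly S k n := by
  induction k generalizing n with
  | zero => rfl
  | succ k ih =>
    simp only [orderPoly, Finset.mem_insert, h.ne, false_or]
    exact Finset.sum_congr rfl fun m _ => by rw [ih (by omega)]

theorem orderPoly_zero (S : Finset ℕ) (k : ℕ) : orderPoly S k 0 = 0 := by
  cases k with
  | zero => rfl
  | succ k => simp only [orderPoly, zero_add, Finset.sum_range_one]; split_ifs <;> simp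

theorem JS_zero_right (n : ℕ) : JS (n + 1) 0 = 0 := by simp [JS]

theorem JS_self (n : ℕ) : JS n n = 1 := by
  induction n with
  | zero => simp [JS]
  | succ n ih => simp [JS, ih, JS_eq_zero]

/-- The case k = n = 0 fails: `JS 0 0` is 1, but `orderPoly` vanishes at 0. -/
theorem JS_add_eq_sum_orderPoly (k n : ℕ) (h : k ≠ 0 ∨ n ≠ 0) :
    JS (n + k) n =
      ∑ S ∈ (Finset.Icc 1 k).powerset, C (orderPoly S k n) * X ^ S.card := by
  induction k generalizing n with
  | zero => simp [JS_self, orderPoly, h.resolve_left (by simp)]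
  | succ k ihk =>
    clear h
    induction n with
    | zero => simp [orderPoly_zero, JS_zero_right]
    | succ n ihn =>
      have hS : ∀ S ∈ (Finset.Icc 1 (k + 1)).powerset,
          C (orderPoly S (k + 1) (n + 1)) * X ^ S.card = C (orderPoly S (k + 1) n) * X ^ S.card +
            C (((n + 1 : ℕ) : ℤ) ^ (if k + 1 ∈ S then 1 else 2) * orderPoly S k (n + 1)) *
              X ^ S.card := by
        intro S _
        rw [orderPoly, Finset.sum_range_succ, C_add, add_mul, ← orderPoly]
      rw [Finset.sum_congr rfl hS, Finset.sum_add_distrib, ← ihn, Icc_one_succ,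
        -- Splitting by whether k + 1 ∈ S separates the two terms of the weight.
        Finset.sum_powerset_insert (by simp), show n + 1 + (k + 1) = (n + 1 + k) + 1 by omega, JS,
        ihk (n + 1) (by simp), Finset.mul_sum, show n + (k + 1) = n + 1 + k by omega,
        ← Finset.sum_add_distrib]
      congr 1
      refine Finset.sum_congr rfl fun S hS => ?_
      have hk : k + 1 ∉ S := fun h => by simpa using Finset.mem_powerset.1 hS h
      rw [orderPoly_insert (Nat.lt_succ_self k), Finset.card_insert_of_notMem hk]
      simp [hk]
      ring

theorem p_eq_sum_orderPoly (k i n : ℕ) (hk : k ≠ 0) :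
    p k i n = ∑ S ∈ Finset.powersetCard i (Finset.Icc 1 k), orderPoly S k n := by
  rw [p, JS_add_eq_sum_orderPoly k n (Or.inl hk), finsetSum_coeff,
    Finset.powersetCard_eq_filter, Finset.sum_filter]
  refine Finset.sum_congr rfl fun S _ => ?_
  rw [coeff_C_mul_X_pow]
  simp [eq_comm]

theorem A_eq_sum_desSeries (k i : ℕ) (hk : k ≠ 0) :
    A k i = ∑ S ∈ Finset.powersetCard i (Finset.Icc 1 k), desSeries (L k S) := by
  have hp : PowerSeries.mk (p k i) = ∑ S ∈ Finset.powersetCard i (Finset.Icc 1 k),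
      PowerSeries.mk (orderPoly S k) := by
    ext n
    simp [p_eq_sum_orderPoly k i n hk]
  rw [A, hp, Finset.mul_sum]
  refine Finset.sum_congr rfl fun S hS => ?_
  obtain ⟨h1, h2⟩ := Finset.mem_powersetCard.1 hS
  rw [← (enumerates_L k S).2, size_eq h1, h2]

/-- A word determines S: m ∈ S exactly when 3m - 2 is missing. -/
theorem L_disjoint {k : ℕ} {S T : Finset ℕ} (hS : S ⊆ Finset.Icc 1 k) (hT : T ⊆ Finset.Icc 1 k)
    (h : S ≠ T) : Disjoint (L k S) (L k T) := by
  refine Finset.disjoint_left.2 fun w hwS hwT => h ?_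
  have key : ∀ U, U ⊆ Finset.Icc 1 k → w ∈ L k U →
      ∀ m, m ∈ U ↔ m ∈ Finset.Icc 1 k ∧ 3 * m - 2 ∉ w := by
    intro U hU hw m
    rw [(mem_L.1 hw).2]
    constructor
    · intro hm
      have := Finset.mem_Icc.1 (hU hm)
      exact ⟨hU hm, fun h => h.2 ⟨m, hm, by omega⟩⟩
    · rintro ⟨hm, hn⟩
      have := Finset.mem_Icc.1 hm
      by_contra hmU
      refine hn ⟨by omega, fun ⟨m', hm', e⟩ => hmU ?_⟩
      rwa [show m = m' by omega]
  ext m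
  rw [key S hS hwS, key T hT hwT]

theorem coeff_desSeries (W : Finset (List ℕ)) (j : ℕ) :
    PowerSeries.coeff j (desSeries W) = ((W.filter fun w => des w + 1 = j).card : ℤ) := by
  simp [desSeries, PowerSeries.coeff_X_pow, eq_comm]

theorem desSeries_LUnion (k i : ℕ) :
    desSeries (LUnion k i) = ∑ S ∈ Finset.powersetCard i (Finset.Icc 1 k), desSeries (L k S) :=
  Finset.sum_biUnion fun _ hS _ hT h =>
    L_disjoint (Finset.mem_powersetCard.1 hS).1 (Finset.mem_powersetCard.1 hT).1 h

theorem coe_descentPoly (k : ℕ) (S : Finset ℕ) :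
    (descentPoly k S : PowerSeries ℤ) = desSeries (L k S) := by
  rw [descentPoly, desSeries, ← Polynomial.coeToPowerSeries.ringHom_apply, map_sum]
  simp

end JacobiStirling

theorem mainTheorem3 (k i : ℕ) (hk : 1 ≤ k) (hi : i ≤ k) :
    JacobiStirling.A k i =
        ((∑ S ∈ Finset.powersetCard i (Finset.Icc 1 k), JacobiStirling.descentPoly k S :
          Polynomial ℤ) : PowerSeries ℤ) ∧
      ∀ j : ℕ, PowerSeries.coeff j (JacobiStirling.A k i) =
        (((JacobiStirling.LUnion k i).filter fun w => JacobiStirling.des w + 1 = j).card : ℤ) := by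
  have h := JacobiStirling.A_eq_sum_desSeries k i (by omega)
  constructor
  · rw [h, ← Polynomial.coeToPowerSeries.ringHom_apply, map_sum]
    exact Finset.sum_congr rfl fun S _ => (JacobiStirling.coe_descentPoly k S).symm
  · intro j
    rw [h, ← JacobiStirling.desSeries_LUnion, JacobiStirling.coeff_desSeries]
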